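/- Let $n\ge 1$ and let $\mathbb H^n=\mathbb C^n\times\mathbb R$ be the Heisenberg group with group law $$(z,t)\cdot(w,s)=\bigl(z+w,\;t+s+\tfrac12\operatorname{Im}(z\cdot\bar w)\bigr),$$ where $z\cdot\bar w=\sum_{j=1}^n z_j\overline{w_j}$, equipped with Lebesgue measure $dz\,dt$. For $\lambda\in\mathbb R^\ast=\mathbb R\setminus\{0\}$ let $\pi_\lambda$ be the Schrödinger representation of $\mathbb H^n$ on $L^2(\mathbb R^n)$, $$\pi_\lambda(z,t)\varphi(\xi)=e^{i\lambda t}\,e^{i\lambda(x\cdot\xi+\frac12 x\cdot y)}\,\varphi(\xi+y),\qquad z=x+iy,$$ and for $f\in L^1(\mathbb H^n)$ let $$\hat f(\lambda)=\int_{\mathbb H^n}f(z,t)\,\pi_\lambda(z,t)\,dz\,dt$$ be its group Fourier transform, a bounded operator on $L^2(\mathbb R^n)$ (the integral being taken in the strong operator sense). Let $A\subset\mathbb C^n$ be a set of finite Lebesgue measure. Suppose that $f\in L^1(\mathbb H^n)$ and that $f(z,t)=0$ for almost every $(z,t)\notin A\times\mathbb R$. If $\hat f(\lambda)$ is a finite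 rank operator for each $\lambda\in\mathbb R^\ast$, then $f=0$ (as an element of $L^1(\mathbb H^n)$, i.e. $f=0$ almost everywhere). -/

import Mathlib

open MeasureTheory Filter Topology
open scoped ENNReal

noncomputable section

/-- The Heisenberg group `ℂⁿ × ℝ`. It carries the product topology and Lebesgue measure
`dz dt` (where `dz = dx dy` for `z = x + i y`). -/
def HeisenbergGroup (n : ℕ) : Type := (Fin n → ℂ) × ℝ

namespace HeisenbergGroup

variable {n : ℕ}

/-- The `ℂⁿ`-component `z` of a point `(z, t)`. -/
def z (g : HeisenbergGroup n) : Fin n → ℂ := g.1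

/-- The central component `t` of a point `(z, t)`. -/
def t (g : HeisenbergGroup n) : ℝ := g.2

/-- The real part `x` of `z = x + i y`. -/
def x (g : HeisenbergGroup n) : Fin n → ℝ := fun j => (g.z j).re

/-- The imaginary part `y` of `z = x + i y`. -/
def y (g : HeisenbergGroup n) : Fin n → ℝ := fun j => (g.z j).im

instance : TopologicalSpace (HeisenbergGroup n) :=
  inferInstanceAs (TopologicalSpace ((Fin n → ℂ) × ℝ))

instance : SecondCountableTopology (HeisenbergGroup n) :=
  inferInstanceAs (SecondCountableTopology ((Fin n → ℂ) × ℝ))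

instance : TopologicalSpace.PseudoMetrizableSpace (HeisenbergGroup n) :=
  inferInstanceAs (TopologicalSpace.PseudoMetrizableSpace ((Fin n → ℂ) × ℝ))

instance : MeasureSpace (HeisenbergGroup n) :=
  inferInstanceAs (MeasureSpace ((Fin n → ℂ) × ℝ))

instance : BorelSpace (HeisenbergGroup n) :=
  inferInstanceAs (BorelSpace ((Fin n → ℂ) × ℝ))

instance : One (HeisenbergGroup n) := ⟨((0 : Fin n → ℂ), (0 : ℝ))⟩

/-- The inverse `(z, t)⁻¹ = (-z, -t)`. -/
instance : Inv (HeisenbergGroup n) := ⟨fun g => (-g.z, -g.t)⟩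

/-- The group law `(z, t) (w, s) = (z + w, t + s + Im (z · w̄) / 2)`. -/
instance : Mul (HeisenbergGroup n) :=
  ⟨fun g h => (g.z + h.z, g.t + h.t + 1 / 2 * (∑ j, g.z j * starRingEnd ℂ (h.z j)).im)⟩

theorem ext {g h : HeisenbergGroup n} (h₁ : g.z = h.z) (h₂ : g.t = h.t) : g = h :=
  Prod.ext h₁ h₂

theorem z_one : (1 : HeisenbergGroup n).z = 0 := rfl
theorem t_one : (1 : HeisenbergGroup n).t = 0 := rfl
theorem z_inv (g : HeisenbergGroup n) : g⁻¹.z = -g.z := rfl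
theorem t_inv (g : HeisenbergGroup n) : g⁻¹.t = -g.t := rfl
theorem z_mul (g h : HeisenbergGroup n) : (g * h).z = g.z + h.z := rfl
theorem t_mul (g h : HeisenbergGroup n) :
    (g * h).t = g.t + h.t + 1 / 2 * (∑ j, g.z j * starRingEnd ℂ (h.z j)).im := rfl

theorem t_mul' (g h : HeisenbergGroup n) :
    (g * h).t = g.t + h.t + 1 / 2 * ((g.y ⬝ᵥ h.x) - (g.x ⬝ᵥ h.y)) := by
  rw [t_mul, Complex.im_sum]
  simp only [dotProduct, x, y, ← Finset.sum_sub_distrib]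
  congr 2
  refine Finset.sum_congr rfl fun j _ => ?_
  simp
  ring

theorem x_mul (g h : HeisenbergGroup n) : (g * h).x = g.x + h.x := by
  ext j; simp [x, z_mul]

theorem y_mul (g h : HeisenbergGroup n) : (g * h).y = g.y + h.y := by
  ext j; simp [y, z_mul]

instance : Group (HeisenbergGroup n) :=
  Group.ofLeftAxioms
    (fun a b c => ext (by simp only [z_mul, add_assoc]) (by
      simp only [t_mul', x_mul, y_mul, add_dotProduct, dotProduct_add]; ring))
    (fun a => ext (by simp [z_mul, z_one]) (by simp [t_mul, t_one, z_one]))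
    (fun a => ext (by simp [z_mul, z_inv, z_one]) (by
      have hx : a⁻¹.x = -a.x := by ext j; simp [x, z_inv]
      have hy : a⁻¹.y = -a.y := by ext j; simp [y, z_inv]
      rw [t_mul', hx, hy, t_inv, t_one, neg_dotProduct, neg_dotProduct, dotProduct_comm a.y]
      ring))

theorem continuous_t : Continuous (t : HeisenbergGroup n → ℝ) :=
  (continuous_snd : Continuous (Prod.snd : (Fin n → ℂ) × ℝ → ℝ))

theorem continuous_z : Continuous (z : HeisenbergGroup n → Fin n → ℂ) :=
  (continuous_fst : Continuous (Prod.fst : (Fin n → ℂ) × ℝ → Fin n → ℂ))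

theorem continuous_x : Continuous (x : HeisenbergGroup n → Fin n → ℝ) :=
  continuous_pi fun j => Complex.continuous_re.comp ((continuous_apply j).comp continuous_z)

theorem continuous_y : Continuous (y : HeisenbergGroup n → Fin n → ℝ) :=
  continuous_pi fun j => Complex.continuous_im.comp ((continuous_apply j).comp continuous_z)

/-- The complex Hilbert space `L²(ℝⁿ)` with respect to Lebesgue measure. -/
abbrev L2 (n : ℕ) : Type := Lp ℂ 2 (volume : Measure (Fin n → ℝ))

/-- The function `ξ ↦ e^{iλt} e^{iλ(x·ξ + x·y/2)} φ(ξ + y)`, where `g = (x + i y, t)`. -/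
def schrodingerFun (lam : ℝ) (g : HeisenbergGroup n) (φ : (Fin n → ℝ) → ℂ) (ξ : Fin n → ℝ) : ℂ :=
  Complex.exp (Complex.I * ((lam * g.t : ℝ) : ℂ)) *
    Complex.exp (Complex.I * ((lam * (g.x ⬝ᵥ ξ + 1 / 2 * (g.x ⬝ᵥ g.y)) : ℝ) : ℂ)) *
    φ (ξ + g.y)

/-- The unimodular factor of `schrodingerFun`. -/
def phase (lam : ℝ) (g : HeisenbergGroup n) (ξ : Fin n → ℝ) : ℂ :=
  Complex.exp (Complex.I * ((lam * g.t : ℝ) : ℂ)) *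
    Complex.exp (Complex.I * ((lam * (g.x ⬝ᵥ ξ + 1 / 2 * (g.x ⬝ᵥ g.y)) : ℝ) : ℂ))

theorem norm_phase (lam : ℝ) (g : HeisenbergGroup n) (ξ : Fin n → ℝ) : ‖phase lam g ξ‖ = 1 := by
  rw [phase, norm_mul, mul_comm Complex.I, mul_comm Complex.I, Complex.norm_exp_ofReal_mul_I,
    Complex.norm_exp_ofReal_mul_I, mul_one]

theorem continuous_phase (lam : ℝ) :
    Continuous fun p : HeisenbergGroup n × (Fin n → ℝ) => phase lam p.1 p.2 := by
  have ht : Continuous fun p : HeisenbergGroup n × (Fin n → ℝ) => p.1.t :=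
    continuous_t.comp continuous_fst
  have hx : Continuous fun p : HeisenbergGroup n × (Fin n → ℝ) => p.1.x :=
    continuous_x.comp continuous_fst
  have hy : Continuous fun p : HeisenbergGroup n × (Fin n → ℝ) => p.1.y :=
    continuous_y.comp continuous_fst
  have h1 : Continuous fun p : HeisenbergGroup n × (Fin n → ℝ) => p.1.x ⬝ᵥ p.2 :=
    hx.dotProduct continuous_snd
  have h2 : Continuous fun p : HeisenbergGroup n × (Fin n → ℝ) => p.1.x ⬝ᵥ p.1.y :=
    hx.dotProduct hy
  unfold phase
  fun_prop

theorem continuous_phase_right (lam : ℝ) (g : HeisenbergGroup n) : Continuous (phase lam g) :=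
  (continuous_phase lam).comp (by fun_prop : Continuous fun ξ : Fin n → ℝ => (g, ξ))

theorem schrodingerFun_eq (lam : ℝ) (g : HeisenbergGroup n) (φ : (Fin n → ℝ) → ℂ) :
    schrodingerFun lam g φ = fun ξ => phase lam g ξ * φ (ξ + g.y) := rfl

theorem memLp_schrodingerFun (lam : ℝ) (g : HeisenbergGroup n) {φ : (Fin n → ℝ) → ℂ}
    (hφ : MemLp φ 2 volume) : MemLp (schrodingerFun lam g φ) 2 volume := by
  have h := hφ.comp_measurePreserving (measurePreserving_add_right volume g.y)
  refine MemLp.of_le h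
    ((continuous_phase_right lam g).aestronglyMeasurable.mul h.aestronglyMeasurable) ?_
  refine Eventually.of_forall fun ξ => ?_
  rw [schrodingerFun_eq]
  simp [norm_phase]

theorem schrodingerFun_congr (lam : ℝ) (g : HeisenbergGroup n) {φ ψ : (Fin n → ℝ) → ℂ}
    (h : φ =ᵐ[volume] ψ) : schrodingerFun lam g φ =ᵐ[volume] schrodingerFun lam g ψ := by
  filter_upwards [(measurePreserving_add_right volume g.y).quasiMeasurePreserving.ae_eq_comp h]
    with ξ hξ
  simp only [Function.comp_apply] at hξ
  simp only [schrodingerFun, hξ]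

theorem schrodingerFun_mul (lam : ℝ) (g h : HeisenbergGroup n) (φ : (Fin n → ℝ) → ℂ) :
    schrodingerFun lam (g * h) φ = schrodingerFun lam g (schrodingerFun lam h φ) := by
  ext ξ
  simp only [schrodingerFun, t_mul', x_mul, y_mul, ← mul_assoc, ← Complex.exp_add,
    add_dotProduct, dotProduct_add, add_assoc]
  rw [dotProduct_comm g.y h.x]
  congr 2
  push_cast
  ring

theorem schrodingerFun_one (lam : ℝ) (φ : (Fin n → ℝ) → ℂ) :
    schrodingerFun lam 1 φ = φ := by
  have hx : (1 : HeisenbergGroup n).x = 0 := rfl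
  have hy : (1 : HeisenbergGroup n).y = 0 := rfl
  ext ξ
  simp [schrodingerFun, hx, hy, t_one]

/-- `schrodingerFun` as a linear isometry of `L²(ℝⁿ)`. -/
def schrodingerIsometry (lam : ℝ) (g : HeisenbergGroup n) : L2 n →ₗᵢ[ℂ] L2 n where
  toFun φ := (memLp_schrodingerFun lam g (Lp.memLp φ)).toLp (schrodingerFun lam g φ)
  map_add' φ ψ := by
    rw [← MemLp.toLp_add]
    refine MemLp.toLp_congr _ _ ((schrodingerFun_congr lam g (Lp.coeFn_add φ ψ)).trans ?_)
    exact Eventually.of_forall fun ξ => by simp [schrodingerFun, mul_add]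
  map_smul' c φ := by
    rw [RingHom.id_apply, ← MemLp.toLp_const_smul]
    refine MemLp.toLp_congr _ _ ((schrodingerFun_congr lam g (Lp.coeFn_smul c φ)).trans ?_)
    exact Eventually.of_forall fun ξ => by simp [schrodingerFun]; ring
  norm_map' φ := by
    change ‖(memLp_schrodingerFun lam g (Lp.memLp φ)).toLp (schrodingerFun lam g φ)‖ = ‖φ‖
    rw [Lp.norm_toLp, Lp.norm_def]
    congr 1
    rw [← eLpNorm_comp_measurePreserving (Lp.aestronglyMeasurable φ)
      (measurePreserving_add_right volume g.y)]
    refine eLpNorm_congr_norm_ae (Eventually.of_forall fun ξ => ?_)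
    rw [schrodingerFun_eq]
    simp [norm_phase]

theorem coeFn_schrodingerIsometry (lam : ℝ) (g : HeisenbergGroup n) (φ : L2 n) :
    schrodingerIsometry lam g φ =ᵐ[volume] schrodingerFun lam g φ :=
  MemLp.coeFn_toLp (memLp_schrodingerFun lam g (Lp.memLp φ))

theorem schrodingerIsometry_mul (lam : ℝ) (g h : HeisenbergGroup n) (φ : L2 n) :
    schrodingerIsometry lam (g * h) φ =
      schrodingerIsometry lam g (schrodingerIsometry lam h φ) := by
  refine Lp.ext ?_
  refine (coeFn_schrodingerIsometry lam (g * h) φ).trans ?_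
  rw [schrodingerFun_mul]
  exact ((coeFn_schrodingerIsometry lam g _).trans
    (schrodingerFun_congr lam g (coeFn_schrodingerIsometry lam h φ))).symm

theorem schrodingerIsometry_one (lam : ℝ) (φ : L2 n) :
    schrodingerIsometry lam (1 : HeisenbergGroup n) φ = φ := by
  refine Lp.ext ((coeFn_schrodingerIsometry lam 1 φ).trans ?_)
  rw [schrodingerFun_one]

/-- The Schrödinger representation `π_λ` of the Heisenberg group on `L²(ℝⁿ)`, by unitary
operators: `π_λ(z, t) φ (ξ) = e^{iλt} e^{iλ(x·ξ + x·y/2)} φ(ξ + y)` for `z = x + i y`. -/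
def schrodingerRep (n : ℕ) (lam : ℝ) : HeisenbergGroup n →* (L2 n ≃ₗᵢ[ℂ] L2 n) where
  toFun g :=
    { toLinearEquiv :=
        { toLinearMap := (schrodingerIsometry lam g).toLinearMap
          invFun := schrodingerIsometry lam g⁻¹
          left_inv := fun φ => by
            change schrodingerIsometry lam g⁻¹ (schrodingerIsometry lam g φ) = φ
            rw [← schrodingerIsometry_mul, inv_mul_cancel, schrodingerIsometry_one]
          right_inv := fun φ => by
            change schrodingerIsometry lam g (schrodingerIsometry lam g⁻¹ φ) = φ
            rw [← schrodingerIsometry_mul, mul_inv_cancel, schrodingerIsometry_one] }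
      norm_map' := (schrodingerIsometry lam g).norm_map }
  map_one' := LinearIsometryEquiv.ext (schrodingerIsometry_one lam)
  map_mul' g h := LinearIsometryEquiv.ext (schrodingerIsometry_mul lam g h)

theorem schrodingerRep_apply (lam : ℝ) (g : HeisenbergGroup n) (φ : L2 n) :
    schrodingerRep n lam g φ = schrodingerIsometry lam g φ := rfl

theorem tendsto_translate (φ : L2 n) (v₀ : Fin n → ℝ) :
    Tendsto (fun v : Fin n → ℝ => eLpNorm (fun ξ => φ (ξ + v) - φ (ξ + v₀)) 2 volume)
      (𝓝 v₀) (𝓝 0) := by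
  have hc : Continuous fun v : Fin n → ℝ =>
      (ContinuousMap.mk (fun ξ : Fin n → ℝ => ξ + v) (by fun_prop) :
        C(Fin n → ℝ, Fin n → ℝ)) :=
    ContinuousMap.continuous_of_continuous_uncurry _ (by
      change Continuous fun p : (Fin n → ℝ) × (Fin n → ℝ) => p.2 + p.1
      fun_prop)
  have h := (Continuous.compMeasurePreservingLp (p := 2) (continuous_const (y := φ)) hc
    (fun v => measurePreserving_add_right volume v) (by norm_num)).tendsto v₀
  rw [Lp.tendsto_Lp_iff_tendsto_eLpNorm'] at h
  refine h.congr fun v => eLpNorm_congr_ae ?_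
  filter_upwards [Lp.coeFn_compMeasurePreserving φ (measurePreserving_add_right volume v),
    Lp.coeFn_compMeasurePreserving φ (measurePreserving_add_right volume v₀)] with ξ h₁ h₂
  simp only [Pi.sub_apply]
  exact congrArg₂ (· - ·) h₁ h₂

theorem tendsto_phase (lam : ℝ) (g₀ : HeisenbergGroup n) {ψ : (Fin n → ℝ) → ℂ}
    (hψ : MemLp ψ 2 volume) :
    Tendsto (fun g => eLpNorm (fun ξ => (phase lam g ξ - phase lam g₀ ξ) * ψ ξ) 2 volume)
      (𝓝 g₀) (𝓝 0) := by
  have key : Tendsto (fun g : HeisenbergGroup n =>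
      ∫⁻ ξ, ‖(phase lam g ξ - phase lam g₀ ξ) * ψ ξ‖ₑ ^ (2 : ℝ)) (𝓝 g₀)
      (𝓝 (∫⁻ _ : Fin n → ℝ, 0)) := by
    refine tendsto_lintegral_filter_of_dominated_convergence'
      (fun ξ => ‖(2 : ℂ) * ψ ξ‖ₑ ^ (2 : ℝ)) ?_ ?_ ?_ ?_
    · refine Eventually.of_forall fun g => ?_
      exact (((((continuous_phase_right lam g).sub
        (continuous_phase_right lam g₀)).aestronglyMeasurable).mul
          hψ.aestronglyMeasurable).enorm).pow_const _
    · refine Eventually.of_forall fun g => Eventually.of_forall fun ξ => ?_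
      refine ENNReal.rpow_le_rpow ?_ (by norm_num)
      rw [enorm_mul, enorm_mul]
      gcongr
      refine enorm_le_iff_norm_le.2 ((norm_sub_le _ _).trans ?_)
      rw [norm_phase, norm_phase]
      norm_num
    · have h2 := (hψ.const_mul (2 : ℂ))
      exact (lintegral_rpow_enorm_lt_top_of_eLpNorm_lt_top (by norm_num) (by norm_num)
        h2.eLpNorm_lt_top).ne
    · refine Eventually.of_forall fun ξ => ?_
      have hc : Continuous fun g : HeisenbergGroup n =>
          ‖(phase lam g ξ - phase lam g₀ ξ) * ψ ξ‖ₑ ^ (2 : ℝ) := by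
        have h1 : Continuous fun g : HeisenbergGroup n => phase lam g ξ :=
          (continuous_phase lam).comp
            (by fun_prop : Continuous fun g : HeisenbergGroup n => (g, ξ))
        exact (ENNReal.continuous_rpow_const).comp
          (((h1.sub continuous_const).mul continuous_const).enorm)
      simpa using hc.tendsto g₀
  rw [lintegral_zero] at key
  have h := (ENNReal.continuous_rpow_const (y := 1 / (2 : ℝ))).tendsto 0 |>.comp key
  rw [ENNReal.zero_rpow_of_pos (by norm_num)] at h
  refine h.congr fun g => ?_
  rw [eLpNorm_eq_lintegral_rpow_enorm_toReal (by norm_num) (by norm_num)]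
  simp

/-- Strong continuity of the Schrödinger representation. -/
theorem continuous_schrodingerRep (lam : ℝ) (φ : L2 n) :
    Continuous fun g : HeisenbergGroup n => schrodingerRep n lam g φ := by
  refine continuous_iff_continuousAt.2 fun g₀ => ?_
  change Tendsto _ _ _
  rw [Lp.tendsto_Lp_iff_tendsto_eLpNorm']
  have hsh : ∀ v : Fin n → ℝ, MemLp (fun ξ => φ (ξ + v)) 2 volume := fun v =>
    (Lp.memLp φ).comp_measurePreserving (measurePreserving_add_right volume v)
  have hsum := ((tendsto_translate φ g₀.y).comp (continuous_y.tendsto g₀)).add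
    (tendsto_phase lam g₀ (hsh g₀.y))
  rw [add_zero] at hsum
  refine tendsto_of_tendsto_of_tendsto_of_le_of_le tendsto_const_nhds hsum
    (fun _ => zero_le) fun g => ?_
  have e : eLpNorm (fun ξ => φ (ξ + g.y) - φ (ξ + g₀.y)) 2 volume =
      eLpNorm (fun ξ => phase lam g ξ * (φ (ξ + g.y) - φ (ξ + g₀.y))) 2 volume :=
    eLpNorm_congr_norm_ae (Eventually.of_forall fun ξ => by simp [norm_phase])
  simp only [Function.comp_apply]
  rw [e]
  refine le_trans (le_of_eq (eLpNorm_congr_ae ?_)) (eLpNorm_add_le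
    ((continuous_phase_right lam g).aestronglyMeasurable.mul
      ((hsh g.y).aestronglyMeasurable.sub (hsh g₀.y).aestronglyMeasurable))
    (((continuous_phase_right lam g).sub (continuous_phase_right lam g₀)).aestronglyMeasurable.mul
      (hsh g₀.y).aestronglyMeasurable) (by norm_num))
  filter_upwards [coeFn_schrodingerIsometry lam g φ, coeFn_schrodingerIsometry lam g₀ φ]
    with ξ h₁ h₂
  simp only [Pi.sub_apply, Pi.add_apply, schrodingerRep_apply, h₁, h₂,
    schrodingerFun_eq]
  ring

theorem integrable_schrodingerRep (lam : ℝ)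
    (f : Lp ℂ 1 (volume : Measure (HeisenbergGroup n))) (φ : L2 n) :
    Integrable fun g : HeisenbergGroup n => f g • schrodingerRep n lam g φ := by
  have hf : Integrable f (volume : Measure (HeisenbergGroup n)) := L1.integrable_coeFn f
  refine Integrable.mono (hf.norm.mul_const ‖φ‖)
    (hf.aestronglyMeasurable.smul (continuous_schrodingerRep lam φ).aestronglyMeasurable) ?_
  exact Eventually.of_forall fun g => by simp [norm_smul]

/-- The group Fourier transform `f̂(λ) = ∫ f(z, t) π_λ(z, t) dz dt` of `f ∈ L¹`, a bounded
operator on `L²(ℝⁿ)`. The integral is taken in the strong sense: `f̂(λ) φ` is the Bochner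
integral in `L²(ℝⁿ)` of the integrable function `(z, t) ↦ f(z, t) π_λ(z, t) φ`. -/
def fourierTransform (f : Lp ℂ 1 (volume : Measure (HeisenbergGroup n))) (lam : ℝ) :
    L2 n →L[ℂ] L2 n :=
  LinearMap.mkContinuous
    { toFun := fun φ => ∫ g : HeisenbergGroup n, f g • schrodingerRep n lam g φ
      map_add' := fun φ ψ => by
        rw [← integral_add (integrable_schrodingerRep lam f φ) (integrable_schrodingerRep lam f ψ)]
        simp only [map_add, smul_add]
      map_smul' := fun c φ => by
        rw [RingHom.id_apply, ← integral_smul]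
        simp only [map_smul, smul_comm c] }
    (∫ g : HeisenbergGroup n, ‖f g‖)
    (fun φ => by
      refine (norm_integral_le_integral_norm _).trans (le_of_eq ?_)
      rw [← integral_mul_const]
      simp only [norm_smul, LinearIsometryEquiv.norm_map])

theorem fourierTransform_apply (f : Lp ℂ 1 (volume : Measure (HeisenbergGroup n))) (lam : ℝ)
    (φ : L2 n) :
    fourierTransform f lam φ = ∫ g : HeisenbergGroup n, f g • schrodingerRep n lam g φ := rfl

end HeisenbergGroup

end

/-! Integrating out `t` first shows that the group Fourier transform at `lam` is the Weyl transform
of `centralFourier f lam`, a function on ℂⁿ supported in `A` up to a null set. So it suffices to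
prove a Benedicks-type theorem for each `lam ≠ 0`: an integrable function on ℂⁿ supported in a set
of finite measure, with Weyl transform of finite rank, vanishes almost everywhere. Uniqueness of the
Fourier transform in `t` then gives `f = 0`.

If the Weyl transform `T` has finite rank, let `e` be an orthonormal basis of its range and `a i`
the adjoint of `T` applied to `e i`. Moyal's identity (`integral_inner_coeff`) and injectivity of
the Weyl transform (`ae_eq_zero_of_integral_mul_coeff`) identify the function, up to a constant and
conjugation, with the finite sum of matrix coefficients `coeffSum lam e a`.

Two facts about such sums with `e` fixed are incompatible unless the sum is zero. By Moyal and
Bessel, the vectors `a` whose sum vanishes off a set `B` of finite measure span a space of dimension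
at most a constant times the measure of `B` (`card_mul_oscConst_le`). But translates of a nonzero
sum are again such sums, up to phase, and small translations enlarge the support by as little as
desired while producing new independent functions (`exists_linearIndependent_coeffSum`). Hence
arbitrarily many independent vectors fit over a set of bounded measure. -/

noncomputable section

open scoped FourierTransform ComplexInnerProductSpace SchwartzMap

/-! ### Plancherel's identity on `L¹ ∩ L²`. -/

section Plancherel

variable {E : Type*} [NormedAddCommGroup E] [InnerProductSpace ℝ E] [FiniteDimensional ℝ E]
  [MeasurableSpace E] [BorelSpace E]

/-- The `L²` Fourier transform of an integrable function is given by the Fourier integral. -/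
theorem fourier_toLp_ae_eq {f : E → ℂ} (hf : Integrable f) (hf2 : MemLp f 2) :
    (𝓕 (hf2.toLp f) : Lp ℂ 2 (volume : Measure E)) =ᵐ[volume] 𝓕 f := by
  refine ae_eq_of_integral_contDiff_smul_eq
    ((Lp.memLp _).locallyIntegrable (by norm_num)) ?_ ?_
  · exact (VectorFourier.fourierIntegral_continuous Real.continuous_fourierChar
      (by exact continuous_inner) hf).locallyIntegrable
  · intro g hg hgc
    have hgc' : HasCompactSupport fun x => (g x : ℂ) := hgc.comp_left Complex.ofReal_zero
    have hg' : ContDiff ℝ (⊤ : ℕ∞) fun x => (g x : ℂ) := Complex.ofRealCLM.contDiff.comp hg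
    set G : 𝓢(E, ℂ) := hgc'.toSchwartzMap hg' with hG
    have hGx : ∀ x, G x = (g x : ℂ) := fun x => rfl
    -- Both sides are tested against the Schwartz function `G`: `h1` moves the `L²` transform onto
    -- `G` by distributional duality, `h2` moves the Fourier integral onto `G` by Fubini.
    have h1 := congrArg (fun T => T G) (Lp.fourier_toTemperedDistribution_eq (hf2.toLp f))
    simp only [TemperedDistribution.fourier_apply, Lp.toTemperedDistribution_apply] at h1
    have h2 : ∫ ξ, 𝓕 f ξ • G ξ = ∫ x, f x • 𝓕 (⇑G) x := by
      have := VectorFourier.integral_fourierIntegral_smul_eq_flip (L := innerₗ E)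
        Real.continuous_fourierChar (by exact continuous_inner) hf (G.integrable (μ := volume))
      rw [flip_innerₗ] at this
      exact this
    calc ∫ x, g x • (𝓕 (hf2.toLp f) : Lp ℂ 2 (volume : Measure E)) x
        = ∫ x, G x • (𝓕 (hf2.toLp f) : Lp ℂ 2 (volume : Measure E)) x := by
          simp [hGx]
      _ = ∫ x, (𝓕 G) x • (hf2.toLp f) x := h1.symm
      _ = ∫ x, f x • 𝓕 (⇑G) x := by
          refine integral_congr_ae ?_
          filter_upwards [hf2.coeFn_toLp] with x hx
          rw [hx, SchwartzMap.fourier_coe, smul_eq_mul, smul_eq_mul, mul_comm]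
      _ = ∫ x, g x • 𝓕 f x := by
          rw [← h2]
          simp [hGx, mul_comm]

theorem memLp_fourier {f : E → ℂ} (hf : Integrable f) (hf2 : MemLp f 2) : MemLp (𝓕 f) 2 :=
  (memLp_congr_ae (fourier_toLp_ae_eq hf hf2)).1 (Lp.memLp _)

/-- Plancherel's identity for functions in `L¹ ∩ L²`. -/
theorem integral_inner_fourier {f g : E → ℂ} (hf : Integrable f) (hf2 : MemLp f 2)
    (hg : Integrable g) (hg2 : MemLp g 2) :
    ∫ ξ, ⟪𝓕 f ξ, 𝓕 g ξ⟫ = ∫ x, ⟪f x, g x⟫ := by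
  have h := Lp.inner_fourier_eq (hf2.toLp f) (hg2.toLp g)
  rw [L2.inner_def, L2.inner_def] at h
  calc _ = _ := integral_congr_ae ?_
    _ = _ := h
    _ = _ := integral_congr_ae ?_
  · filter_upwards [fourier_toLp_ae_eq hf hf2, fourier_toLp_ae_eq hg hg2] with x h1 h2
    rw [h1, h2]
  · filter_upwards [hf2.coeFn_toLp, hg2.coeFn_toLp] with x h1 h2
    rw [h1, h2]

end Plancherel

/-! ### Uniqueness of the Fourier transform of an integrable function. -/

section Uniqueness

theorem MeasureTheory.Integrable.mul_cexp {W : Type*} [MeasurableSpace W] {μ : Measure W}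
    {k : W → ℂ} (hk : Integrable k μ) {θ : W → ℝ} (hθ : Measurable θ) :
    Integrable (fun v => k v * Complex.exp (θ v * Complex.I)) μ := by
  refine hk.mul_bdd (c := 1) (by fun_prop) ?_
  exact Eventually.of_forall fun v => (Complex.norm_exp_ofReal_mul_I _).le

variable {W : Type*} [NormedAddCommGroup W] [NormedSpace ℝ W] [CompleteSpace W]
  [SecondCountableTopology W] [MeasurableSpace W] [BorelSpace W] {μ : Measure W}

/-- The positive and negative parts of `k` are densities of finite measures with equal
characteristic functions, so these measures, and hence the densities, coincide. -/
theorem ae_eq_zero_of_integral_mul_cexp_of_real {k : W → ℝ} (hk : Integrable k μ)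
    (h : ∀ L : StrongDual ℝ W, ∫ v, (k v : ℂ) * Complex.exp (L v * Complex.I) ∂μ = 0) :
    k =ᵐ[μ] 0 := by
  have e : ∀ r : W → ℝ, Integrable r μ → ∀ L : StrongDual ℝ W,
      charFunDual (μ.withDensity fun v => ENNReal.ofReal (r v)) L =
        ∫ v, ((max (r v) 0 : ℝ) : ℂ) * Complex.exp (L v * Complex.I) ∂μ := by
    intro r hr L
    rw [charFunDual_apply, integral_withDensity_eq_integral_toReal_smul₀
      hr.aemeasurable.ennreal_ofReal (Eventually.of_forall fun _ => ENNReal.ofReal_lt_top)]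
    refine integral_congr_ae (Eventually.of_forall fun v => ?_)
    simp [ENNReal.toReal_ofReal']
  have : IsFiniteMeasure (μ.withDensity fun v => ENNReal.ofReal (k v)) :=
    isFiniteMeasure_withDensity_ofReal hk.2
  have : IsFiniteMeasure (μ.withDensity fun v => ENNReal.ofReal (-k v)) :=
    isFiniteMeasure_withDensity_ofReal hk.neg.2
  have key : (μ.withDensity fun v => ENNReal.ofReal (k v)) =
      μ.withDensity fun v => ENNReal.ofReal (-k v) := by
    refine Measure.ext_of_charFunDual (funext fun L => ?_)
    rw [e _ hk, e (fun v => -k v) hk.neg, ← sub_eq_zero, ← integral_sub, ← h L]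
    · refine integral_congr_ae (Eventually.of_forall fun v => ?_)
      simp only
      rw [← sub_mul, ← Complex.ofReal_sub]
      congr 2
      rcases le_total (k v) 0 with h0 | h0
      · rw [max_eq_right h0, max_eq_left (by linarith)]; ring
      · rw [max_eq_left h0, max_eq_right (by linarith)]; ring
    · exact Integrable.mul_cexp hk.pos_part.ofReal (by fun_prop)
    · exact Integrable.mul_cexp hk.neg.pos_part.ofReal (by fun_prop)
  have hfin : ∫⁻ v, ENNReal.ofReal (k v) ∂μ ≠ ∞ := by
    have := measure_ne_top (μ.withDensity fun v => ENNReal.ofReal (k v)) Set.univ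
    rwa [withDensity_apply _ MeasurableSet.univ, Measure.restrict_univ] at this
  have h3 := (withDensity_eq_iff hk.aemeasurable.ennreal_ofReal
    hk.neg.aemeasurable.ennreal_ofReal hfin).1 key
  filter_upwards [h3] with v hv
  simp only [Pi.neg_apply, Pi.zero_apply] at hv ⊢
  rcases le_total (k v) 0 with h0 | h0
  · rw [ENNReal.ofReal_of_nonpos h0, eq_comm, ENNReal.ofReal_eq_zero] at hv
    linarith
  · rw [ENNReal.ofReal_of_nonpos (by linarith : -k v ≤ 0), ENNReal.ofReal_eq_zero] at hv
    linarith

/-- An integrable function is determined by its Fourier transform. -/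
theorem ae_eq_zero_of_integral_mul_cexp {k : W → ℂ} (hk : Integrable k μ)
    (h : ∀ L : StrongDual ℝ W, ∫ v, k v * Complex.exp (L v * Complex.I) ∂μ = 0) :
    k =ᵐ[μ] 0 := by
  -- Conjugating the hypothesis at `-L` gives the same vanishing for the conjugate of `k`, which
  -- reduces the claim to real and imaginary parts.
  have hc : ∀ L : StrongDual ℝ W,
      ∫ v, starRingEnd ℂ (k v) * Complex.exp (L v * Complex.I) ∂μ = 0 := by
    intro L
    rw [← map_zero (starRingEnd ℂ), ← h (-L), ← integral_conj]
    refine integral_congr_ae (Eventually.of_forall fun v => ?_)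
    simp [← Complex.exp_conj]
  have hk' : Integrable (fun v => starRingEnd ℂ (k v)) μ :=
    (LinearIsometryEquiv.integrable_comp_iff Complex.conjLIE).2 hk
  have hre : (fun v => (k v).re) =ᵐ[μ] 0 := by
    refine ae_eq_zero_of_integral_mul_cexp_of_real hk.re fun L => ?_
    have := integral_add (Integrable.mul_cexp hk L.measurable)
      (Integrable.mul_cexp hk' L.measurable)
    rw [h, hc, add_zero] at this
    rw [← mul_zero (1 / 2 : ℂ), ← this, ← integral_const_mul]
    refine integral_congr_ae (Eventually.of_forall fun v => ?_)
    simp only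
    rw [← add_mul, Complex.add_conj]
    push_cast; ring
  have him : (fun v => (k v).im) =ᵐ[μ] 0 := by
    refine ae_eq_zero_of_integral_mul_cexp_of_real hk.im fun L => ?_
    have := integral_sub (Integrable.mul_cexp hk L.measurable)
      (Integrable.mul_cexp hk' L.measurable)
    rw [h, hc, sub_zero] at this
    rw [← mul_zero (1 / (2 * Complex.I) : ℂ), ← this, ← integral_const_mul]
    refine integral_congr_ae (Eventually.of_forall fun v => ?_)
    simp only
    rw [← sub_mul, Complex.sub_conj]
    have := Complex.I_ne_zero
    push_cast; field_simp
  filter_upwards [hre, him] with v h1 h2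
  exact Complex.ext h1 h2

end Uniqueness

/-! ### Plancherel for the oscillatory integrals of the Schrödinger representation. -/

variable {n : ℕ}

/-- The oscillatory integral `x ↦ ∫ e^{iλ x·ξ} f(ξ) dξ`. -/
def oscIntegral (lam : ℝ) (f : (Fin n → ℝ) → ℂ) (x : Fin n → ℝ) : ℂ :=
  ∫ ξ, Complex.exp (Complex.I * ((lam * (x ⬝ᵥ ξ) : ℝ) : ℂ)) * f ξ

/-- The sup-normed `Fin n → ℝ` is identified with Euclidean space by a volume-preserving map. The
frequency factor turns the kernel `e^{-2πi⟨v,w⟩}` into `e^{iλ x·ξ}`; its Jacobian is the origin of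
`oscConst`. -/
theorem oscIntegral_eq_fourier (lam : ℝ) (f : (Fin n → ℝ) → ℂ) (x : Fin n → ℝ) :
    oscIntegral lam f x =
      𝓕 (fun v : EuclideanSpace ℝ (Fin n) => f (WithLp.ofLp v))
        ((-(lam / (2 * Real.pi))) • WithLp.toLp 2 x) := by
  rw [Real.fourier_eq', oscIntegral, ← (PiLp.volume_preserving_toLp (Fin n)).integral_comp
    (MeasurableEquiv.toLp 2 (Fin n → ℝ)).measurableEmbedding]
  refine integral_congr_ae (Eventually.of_forall fun ξ => ?_)
  simp only [smul_eq_mul]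
  congr 2
  rw [inner_smul_right, EuclideanSpace.inner_toLp_toLp, mul_comm Complex.I]
  congr 2
  have := Real.pi_ne_zero
  simp only [star_trivial]
  field_simp

theorem memLp_comp_ofLp {f : (Fin n → ℝ) → ℂ} {p : ℝ≥0∞} (hf : MemLp f p) :
    MemLp (fun v : EuclideanSpace ℝ (Fin n) => f (WithLp.ofLp v)) p :=
  hf.comp_measurePreserving (PiLp.volume_preserving_ofLp (Fin n))

theorem integral_comp_smul_toLp (F : EuclideanSpace ℝ (Fin n) → ℂ) (r : ℝ) :
    ∫ x : Fin n → ℝ, F (r • WithLp.toLp 2 x) = (|(r ^ n)⁻¹| : ℝ) * ∫ v, F v := by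
  have h := Measure.integral_comp_smul (volume : Measure (EuclideanSpace ℝ (Fin n))) F r
  rw [finrank_euclideanSpace_fin] at h
  rw [← Complex.real_smul, ← h]
  exact (PiLp.volume_preserving_toLp (Fin n)).integral_comp
    (MeasurableEquiv.toLp 2 (Fin n → ℝ)).measurableEmbedding (fun v => F (r • v))

theorem integrable_comp_smul_toLp {F : EuclideanSpace ℝ (Fin n) → ℂ} (hF : Integrable F)
    {r : ℝ} (hr : r ≠ 0) : Integrable fun x : Fin n → ℝ => F (r • WithLp.toLp 2 x) := by
  have h := (integrable_comp_smul_iff (volume : Measure (EuclideanSpace ℝ (Fin n))) F hr).2 hF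
  exact (PiLp.volume_preserving_toLp (Fin n)).integrable_comp_of_integrable h

/-- The constant in the Plancherel identity for `oscIntegral`. -/
def oscConst (n : ℕ) (lam : ℝ) : ℝ := |((-(lam / (2 * Real.pi))) ^ n)⁻¹|

theorem oscConst_pos (n : ℕ) {lam : ℝ} (hlam : lam ≠ 0) : 0 < oscConst n lam := by
  have hr : -(lam / (2 * Real.pi)) ≠ 0 := neg_ne_zero.2 (div_ne_zero hlam (by positivity))
  exact abs_pos.2 (inv_ne_zero (pow_ne_zero n hr))

theorem integrable_inner_oscIntegral {lam : ℝ} (hlam : lam ≠ 0) {f g : (Fin n → ℝ) → ℂ}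
    (hf : Integrable f) (hf2 : MemLp f 2) (hg : Integrable g) (hg2 : MemLp g 2) :
    Integrable fun x => ⟪oscIntegral lam f x, oscIntegral lam g x⟫ := by
  simp only [oscIntegral_eq_fourier]
  have hr : -(lam / (2 * Real.pi)) ≠ 0 := neg_ne_zero.2 (div_ne_zero hlam (by positivity))
  refine integrable_comp_smul_toLp (F := fun w =>
    ⟪𝓕 (fun v : EuclideanSpace ℝ (Fin n) => f (WithLp.ofLp v)) w,
      𝓕 (fun v : EuclideanSpace ℝ (Fin n) => g (WithLp.ofLp v)) w⟫) ?_ hr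
  simp only [RCLike.inner_apply]
  have h1 := memLp_fourier (memLp_one_iff_integrable.1
    (memLp_comp_ofLp (memLp_one_iff_integrable.2 hf))) (memLp_comp_ofLp hf2)
  have h2 := memLp_fourier (memLp_one_iff_integrable.1
    (memLp_comp_ofLp (memLp_one_iff_integrable.2 hg))) (memLp_comp_ofLp hg2)
  exact h2.integrable_mul h1.star

theorem integral_inner_oscIntegral {lam : ℝ} {f g : (Fin n → ℝ) → ℂ}
    (hf : Integrable f) (hf2 : MemLp f 2) (hg : Integrable g) (hg2 : MemLp g 2) :
    ∫ x, ⟪oscIntegral lam f x, oscIntegral lam g x⟫ = oscConst n lam * ∫ ξ, ⟪f ξ, g ξ⟫ := by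
  simp only [oscIntegral_eq_fourier]
  rw [integral_comp_smul_toLp (fun w =>
    ⟪𝓕 (fun v : EuclideanSpace ℝ (Fin n) => f (WithLp.ofLp v)) w,
      𝓕 (fun v : EuclideanSpace ℝ (Fin n) => g (WithLp.ofLp v)) w⟫),
    integral_inner_fourier (memLp_one_iff_integrable.1
    (memLp_comp_ofLp (memLp_one_iff_integrable.2 hf))) (memLp_comp_ofLp hf2)
    (memLp_one_iff_integrable.1
    (memLp_comp_ofLp (memLp_one_iff_integrable.2 hg))) (memLp_comp_ofLp hg2), oscConst]
  congr 1
  exact (PiLp.volume_preserving_ofLp (Fin n)).integral_comp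
    (MeasurableEquiv.toLp 2 (Fin n → ℝ)).symm.measurableEmbedding (fun v => ⟪f v, g v⟫)

/-! ### Matrix coefficients and Moyal's identity. -/

namespace HeisenbergGroup

/-- The element `(z, t)` of the Heisenberg group. -/
def of (z : Fin n → ℂ) (t : ℝ) : HeisenbergGroup n := (z, t)

theorem z_of (z : Fin n → ℂ) (t : ℝ) : (of z t).z = z := rfl
theorem t_of (z : Fin n → ℂ) (t : ℝ) : (of z t).t = t := rfl

theorem continuous_of : Continuous fun p : (Fin n → ℂ) × ℝ => of p.1 p.2 :=
  continuous_id (X := (Fin n → ℂ) × ℝ)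

/-- The matrix coefficient `z ↦ ⟪β, π_λ(z, 0) α⟫`. -/
def coeff (lam : ℝ) (β α : L2 n) (z : Fin n → ℂ) : ℂ := ⟪β, schrodingerRep n lam (of z 0) α⟫

theorem continuous_coeff (lam : ℝ) (β α : L2 n) : Continuous (coeff lam β α) :=
  continuous_const.inner ((continuous_schrodingerRep lam α).comp
    (continuous_of.comp (by fun_prop : Continuous fun z : Fin n → ℂ => (z, (0 : ℝ)))))

theorem norm_coeff_le (lam : ℝ) (β α : L2 n) (z : Fin n → ℂ) :
    ‖coeff lam β α z‖ ≤ ‖β‖ * ‖α‖ := by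
  refine (norm_inner_le_norm _ _).trans_eq ?_
  rw [LinearIsometryEquiv.norm_map]

/-- The function `ξ ↦ conj β(ξ) α(ξ + y)`. -/
def crossTerm (β α : L2 n) (y ξ : Fin n → ℝ) : ℂ := α (ξ + y) * starRingEnd ℂ (β ξ)

/-- For fixed `y`, a matrix coefficient is, up to a phase, a Fourier transform in `x`, so Plancherel
applies slice by slice. -/
theorem coeff_eq_oscIntegral (lam : ℝ) (β α : L2 n) (z : Fin n → ℂ) :
    coeff lam β α z =
      Complex.exp (Complex.I * ((lam * (1 / 2 * ((of z 0).x ⬝ᵥ (of z 0).y)) : ℝ) : ℂ)) *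
        oscIntegral lam (crossTerm β α (of z 0).y) (of z 0).x := by
  rw [coeff, L2.inner_def, oscIntegral, ← integral_const_mul]
  refine integral_congr_ae ?_
  filter_upwards [coeFn_schrodingerIsometry lam (of z 0) α] with ξ hξ
  rw [schrodingerRep_apply, hξ, RCLike.inner_apply, schrodingerFun, t_of, crossTerm]
  simp only [mul_zero, Complex.ofReal_zero, Complex.exp_zero, one_mul, ← mul_assoc,
    ← Complex.exp_add]
  congr 3
  push_cast
  ring

/-- The phase depends only on `z` and `lam`, so it cancels between the two coefficients. -/
theorem inner_coeff (lam : ℝ) (β α β' α' : L2 n) (z : Fin n → ℂ) :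
    ⟪coeff lam β α z, coeff lam β' α' z⟫ =
      ⟪oscIntegral lam (crossTerm β α (of z 0).y) (of z 0).x,
        oscIntegral lam (crossTerm β' α' (of z 0).y) (of z 0).x⟫ := by
  rw [coeff_eq_oscIntegral, coeff_eq_oscIntegral]
  simp only [RCLike.inner_apply, map_mul]
  rw [mul_mul_mul_comm, Complex.mul_conj, mul_comm Complex.I, Complex.normSq_eq_norm_sq,
    Complex.norm_exp_ofReal_mul_I]
  simp

/-- `ℂⁿ ≃ ℝⁿ × ℝⁿ`, `z ↦ (Re z, Im z)`. -/
def reIm (n : ℕ) : (Fin n → ℂ) ≃ᵐ (Fin n → ℝ) × (Fin n → ℝ) :=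
  (MeasurableEquiv.piCongrRight fun _ => Complex.measurableEquivRealProd).trans
    (MeasurableEquiv.arrowProdEquivProdArrow ℝ ℝ (Fin n))

theorem reIm_apply (z : Fin n → ℂ) : reIm n z = ((of z 0).x, (of z 0).y) := rfl

theorem measurePreserving_reIm : MeasurePreserving (reIm n) :=
  (volume_measurePreserving_arrowProdEquivProdArrow ℝ ℝ (Fin n)).comp
    (volume_preserving_pi fun _ => Complex.volume_preserving_equiv_real_prod)

theorem inner_crossTerm (β α β' α' : L2 n) (ξ y : Fin n → ℝ) :
    ⟪crossTerm β α y ξ, crossTerm β' α' y ξ⟫ = ⟪β' ξ, β ξ⟫ * ⟪α (ξ + y), α' (ξ + y)⟫ := by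
  simp only [crossTerm, RCLike.inner_apply, map_mul, Complex.conj_conj]
  ring

theorem integrable_inner_crossTerm (β α β' α' : L2 n) :
    Integrable fun p : (Fin n → ℝ) × (Fin n → ℝ) =>
      ⟪crossTerm β α p.2 p.1, crossTerm β' α' p.2 p.1⟫ := by
  simp only [inner_crossTerm]
  exact (measurePreserving_prod_add volume volume).integrable_comp_of_integrable
    ((L2.integrable_inner β' β).mul_prod (L2.integrable_inner α α'))

/-- The shear `(ξ, y) ↦ (ξ, ξ + y)` preserves measure and separates the variables. -/
theorem integral_inner_crossTerm (β α β' α' : L2 n) :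
    ∫ p : (Fin n → ℝ) × (Fin n → ℝ),
      ⟪crossTerm β α p.2 p.1, crossTerm β' α' p.2 p.1⟫ = ⟪β', β⟫ * ⟪α, α'⟫ := by
  simp only [inner_crossTerm]
  rw [L2.inner_def, L2.inner_def, ← integral_prod_mul]
  exact (measurePreserving_prod_add volume volume).integral_comp
    (MeasurableEquiv.shearAddRight (Fin n → ℝ)).measurableEmbedding
    (fun p : (Fin n → ℝ) × (Fin n → ℝ) => ⟪β' p.1, β p.1⟫ * ⟪α p.2, α' p.2⟫)

theorem memLp_translate (α : L2 n) (y : Fin n → ℝ) : MemLp (fun ξ => α (ξ + y)) 2 :=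
  (Lp.memLp α).comp_measurePreserving (measurePreserving_add_right volume y)

theorem integrable_crossTerm (β α : L2 n) (y : Fin n → ℝ) : Integrable (crossTerm β α y) :=
  (memLp_translate α y).integrable_mul (Lp.memLp β).star

/-- The squared modulus is jointly integrable in `(ξ, y)`, so Fubini gives the claim on almost every
slice. -/
theorem ae_memLp_crossTerm (β α : L2 n) : ∀ᵐ y : Fin n → ℝ, MemLp (crossTerm β α y) 2 := by
  filter_upwards [(integrable_inner_crossTerm β α β α).prod_left_ae] with y hy
  refine (memLp_two_iff_integrable_sq_norm (integrable_crossTerm β α y).1).2 ?_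
  refine hy.re.congr (Eventually.of_forall fun ξ => ?_)
  exact (norm_sq_eq_re_inner (𝕜 := ℂ) _).symm

theorem aestronglyMeasurable_inner_oscIntegral (lam : ℝ) (β α β' α' : L2 n) :
    AEStronglyMeasurable fun p : (Fin n → ℝ) × (Fin n → ℝ) =>
      ⟪oscIntegral lam (crossTerm β α p.2) p.1, oscIntegral lam (crossTerm β' α' p.2) p.1⟫ := by
  have h : StronglyMeasurable fun z : Fin n → ℂ =>
      ⟪coeff lam β α z, coeff lam β' α' z⟫ :=
    ((continuous_coeff lam β α).inner (continuous_coeff lam β' α')).stronglyMeasurable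
  refine ((h.comp_measurable (reIm n).symm.measurable).aestronglyMeasurable).congr
    (Eventually.of_forall fun p => ?_)
  simp only [Function.comp_apply, inner_coeff]
  have := (reIm n).apply_symm_apply p
  rw [reIm_apply] at this
  rw [← congrArg Prod.fst this, ← congrArg Prod.snd this]

/-- Here the integrand is nonnegative, so slicewise Plancherel computes the integral of its norm
over `x`, and the result is integrable in `y`. -/
theorem integrable_inner_oscIntegral_crossTerm {lam : ℝ} (hlam : lam ≠ 0) (β α : L2 n) :
    Integrable fun p : (Fin n → ℝ) × (Fin n → ℝ) =>
      ⟪oscIntegral lam (crossTerm β α p.2) p.1, oscIntegral lam (crossTerm β α p.2) p.1⟫ := by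
  have hn : ∀ w : ℂ, ((‖⟪w, w⟫‖ : ℝ) : ℂ) = ⟪w, w⟫ := inner_self_ofReal_norm
  refine (integrable_prod_iff'
    (aestronglyMeasurable_inner_oscIntegral lam β α β α)).2 ⟨?_, ?_⟩
  · filter_upwards [ae_memLp_crossTerm β α] with y hy
    exact integrable_inner_oscIntegral hlam (integrable_crossTerm β α y) hy
      (integrable_crossTerm β α y) hy
  · refine (((integrable_inner_crossTerm β α β α).integral_prod_right).re.const_mul
      (oscConst n lam)).congr ?_
    filter_upwards [ae_memLp_crossTerm β α] with y hy
    rw [← Complex.ofReal_inj, ← integral_complex_ofReal]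
    simp only [hn]
    rw [integral_inner_oscIntegral (integrable_crossTerm β α y) hy
      (integrable_crossTerm β α y) hy]
    push_cast
    have h : ∫ ξ, ⟪crossTerm β α y ξ, crossTerm β α y ξ⟫ =
        ((∫ ξ, ‖⟪crossTerm β α y ξ, crossTerm β α y ξ⟫‖ : ℝ) : ℂ) := by
      rw [← integral_complex_ofReal]
      simp only [hn]
    rw [h]
    simp

theorem memLp_coeff {lam : ℝ} (hlam : lam ≠ 0) (β α : L2 n) : MemLp (coeff lam β α) 2 := by
  refine (memLp_two_iff_integrable_sq_norm
    (continuous_coeff lam β α).aestronglyMeasurable).2 ?_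
  refine (measurePreserving_reIm.integrable_comp_of_integrable
    (integrable_inner_oscIntegral_crossTerm hlam β α)).re.congr
    (Eventually.of_forall fun z => ?_)
  simp only [Function.comp_apply, reIm_apply]
  rw [← inner_coeff]
  exact (norm_sq_eq_re_inner (𝕜 := ℂ) _).symm

theorem integrable_inner_coeff {lam : ℝ} (hlam : lam ≠ 0) (β α β' α' : L2 n) :
    Integrable fun z => ⟪coeff lam β α z, coeff lam β' α' z⟫ :=
  (memLp_coeff hlam β' α').integrable_mul (memLp_coeff hlam β α).star

/-- Moyal's identity (the Schur orthogonality relations) for the Schrödinger representation. -/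
theorem integral_inner_coeff {lam : ℝ} (hlam : lam ≠ 0) (β α β' α' : L2 n) :
    ∫ z, ⟪coeff lam β α z, coeff lam β' α' z⟫ =
      oscConst n lam * (⟪β', β⟫ * ⟪α, α'⟫) := by
  have hI := integrable_inner_coeff hlam β α β' α'
  simp only [inner_coeff] at hI ⊢
  set F : (Fin n → ℝ) × (Fin n → ℝ) → ℂ := fun p =>
    ⟪oscIntegral lam (crossTerm β α p.2) p.1, oscIntegral lam (crossTerm β' α' p.2) p.1⟫
  have hF : Integrable F :=
    (measurePreserving_reIm.integrable_comp_emb (reIm n).measurableEmbedding).1 hI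
  calc _ = ∫ p, F p :=
        measurePreserving_reIm.integral_comp (reIm n).measurableEmbedding F
    _ = ∫ y, ∫ x, F (x, y) := integral_prod_symm F hF
    _ = ∫ y, oscConst n lam * ∫ ξ, ⟪crossTerm β α y ξ, crossTerm β' α' y ξ⟫ := by
        refine integral_congr_ae ?_
        filter_upwards [ae_memLp_crossTerm β α, ae_memLp_crossTerm β' α'] with y h1 h2
        exact integral_inner_oscIntegral (integrable_crossTerm β α y) h1
          (integrable_crossTerm β' α' y) h2
    _ = oscConst n lam * (⟪β', β⟫ * ⟪α, α'⟫) := by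
        rw [integral_const_mul, ← integral_inner_crossTerm]
        congr 1
        exact (integral_prod_symm _ (integrable_inner_crossTerm β α β' α')).symm

end HeisenbergGroup

/-! ### Injectivity of the Weyl transform. -/

namespace HeisenbergGroup

theorem schrodingerRep_of (lam : ℝ) (z : Fin n → ℂ) (t : ℝ) (φ : L2 n) :
    schrodingerRep n lam (of z t) φ =
      Complex.exp (((lam * t : ℝ) : ℂ) * Complex.I) • schrodingerRep n lam (of z 0) φ := by
  refine Lp.ext ?_
  filter_upwards [coeFn_schrodingerIsometry lam (of z t) φ,
    coeFn_schrodingerIsometry lam (of z 0) φ, Lp.coeFn_smul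
      (Complex.exp (((lam * t : ℝ) : ℂ) * Complex.I)) (schrodingerRep n lam (of z 0) φ)]
    with ξ h1 h2 h3
  rw [h3, Pi.smul_apply, schrodingerRep_apply, schrodingerRep_apply, h1, h2, schrodingerFun,
    schrodingerFun, mul_comm Complex.I]
  simp only [t_of, mul_zero, Complex.ofReal_zero, Complex.exp_zero, one_mul, smul_eq_mul,
    mul_assoc]
  rfl

/-- The symplectic form `Im (z · w̄)` on `ℂⁿ`. -/
def symp (z w : Fin n → ℂ) : ℝ := (∑ j, z j * starRingEnd ℂ (w j)).im

theorem symp_swap (z w : Fin n → ℂ) : symp w z = -symp z w := by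
  simp only [symp, Complex.im_sum, ← Finset.sum_neg_distrib]
  refine Finset.sum_congr rfl fun j _ => ?_
  simp
  ring

theorem schrodingerRep_of_of (lam : ℝ) (z w : Fin n → ℂ) (φ : L2 n) :
    schrodingerRep n lam (of z 0) (schrodingerRep n lam (of w 0) φ) =
      Complex.exp (((lam * (1 / 2 * symp z w) : ℝ) : ℂ) * Complex.I) •
        schrodingerRep n lam (of (z + w) 0) φ := by
  rw [← schrodingerRep_of]
  have : of (z + w) (1 / 2 * symp z w) = of z 0 * of w 0 :=
    HeisenbergGroup.ext (by rw [z_mul]; rfl) (by rw [t_mul]; simp [t_of, symp, z_of])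
  rw [this, map_mul]
  rfl

/-- Conjugation by `π_λ(w, 0)` multiplies a coefficient by a character of ℂⁿ. With `exists_symp_eq`,
the coefficients are thus stable under multiplication by every character. -/
theorem coeff_conj (lam : ℝ) (β α : L2 n) (z w : Fin n → ℂ) :
    coeff lam (schrodingerRep n lam (of w 0) β) (schrodingerRep n lam (of w 0) α) z =
      coeff lam β α z * Complex.exp (((lam * symp z w : ℝ) : ℂ) * Complex.I) := by
  have h : schrodingerRep n lam (of (z + w) 0) α =
      Complex.exp (((lam * (1 / 2 * symp z w) : ℝ) : ℂ) * Complex.I) •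
        schrodingerRep n lam (of w 0) (schrodingerRep n lam (of z 0) α) := by
    rw [schrodingerRep_of_of, smul_smul, ← Complex.exp_add, symp_swap z w, add_comm w z]
    simp
  rw [coeff, schrodingerRep_of_of, h, smul_smul, inner_smul_right,
    LinearIsometryEquiv.inner_map_map, ← Complex.exp_add, mul_comm, coeff]
  congr 2
  push_cast
  ring

/-- This is nondegeneracy of the symplectic form. -/
theorem exists_symp_eq {lam : ℝ} (hlam : lam ≠ 0) (L : StrongDual ℝ (Fin n → ℂ)) :
    ∃ w : Fin n → ℂ, ∀ z, lam * symp z w = L z := by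
  refine ⟨fun j => ⟨L (Pi.single j Complex.I) / lam, -(L (Pi.single j 1) / lam)⟩, fun z => ?_⟩
  have hL : L z = ∑ j, L (Pi.single j (z j)) := by
    rw [← map_sum, Finset.univ_sum_single]
  rw [hL, symp, Complex.im_sum, Finset.mul_sum]
  refine Finset.sum_congr rfl fun j _ => ?_
  have : (Pi.single j (z j) : Fin n → ℂ) =
      (z j).re • (Pi.single j 1 : Fin n → ℂ) +
        (z j).im • (Pi.single j Complex.I : Fin n → ℂ) := by
    rw [← Pi.single_smul, ← Pi.single_smul, ← Pi.single_add]
    congr 1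
    apply Complex.ext <;> simp
  rw [this, map_add, map_smul, map_smul]
  simp
  field_simp

theorem exists_L2_ne_zero (n : ℕ) : ∃ α : L2 n, α ≠ 0 := by
  refine ⟨indicatorConstLp 2 (measurableSet_ball (x := (0 : Fin n → ℝ)) (ε := 1))
    measure_ball_lt_top.ne 1, fun h => ?_⟩
  have h1 := congrArg norm h
  rw [norm_indicatorConstLp (by norm_num) (by norm_num), norm_zero, norm_one, one_mul] at h1
  have h2 : 0 < volume.real (Metric.ball (0 : Fin n → ℝ) 1) :=
    ENNReal.toReal_pos (Metric.measure_ball_pos volume _ one_pos).ne' measure_ball_lt_top.ne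
  exact (Real.rpow_pos_of_pos h2 _).ne' h1

/-- A function on `ℂⁿ` whose products with all matrix coefficients of `π_λ` are integrable and
have vanishing integral is zero almost everywhere. -/
theorem ae_eq_zero_of_integral_mul_coeff {lam : ℝ} (hlam : lam ≠ 0) {G : (Fin n → ℂ) → ℂ}
    (hG : ∀ β α : L2 n, Integrable fun z => G z * coeff lam β α z)
    (h : ∀ β α : L2 n, ∫ z, G z * coeff lam β α z = 0) : G =ᵐ[volume] 0 := by
  have hzero : ∀ β α : L2 n, (fun z => G z * coeff lam β α z) =ᵐ[volume] 0 := by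
    intro β α
    refine ae_eq_zero_of_integral_mul_cexp (hG β α) fun L => ?_
    obtain ⟨w, hw⟩ := exists_symp_eq hlam L
    rw [← h (schrodingerRep n lam (of w 0) β) (schrodingerRep n lam (of w 0) α)]
    refine integral_congr_ae (Eventually.of_forall fun z => ?_)
    simp only
    rw [coeff_conj, hw, mul_assoc]
  obtain ⟨α, hα⟩ := exists_L2_ne_zero n
  -- Near each `z₀` some coefficient has no zeros: for `β = π_λ(z₀, 0) α` its value at `z₀` is
  -- `‖β‖²`, and it is continuous.
  refine measure_null_of_locally_null _ fun z₀ _ => ?_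
  set β := schrodingerRep n lam (of z₀ 0) α
  have h0 : coeff lam β α z₀ ≠ 0 := inner_self_ne_zero.2 fun h => hα <| by
    simpa [β] using h
  refine ⟨{z | coeff lam β α z ≠ 0} ∩ {z | G z = 0}ᶜ, ?_, ?_⟩
  · exact inter_mem (mem_nhdsWithin_of_mem_nhds
      ((continuous_coeff lam β α).continuousAt.eventually_ne h0)) self_mem_nhdsWithin
  · refine measure_mono_null ?_ (hzero β α)
    rintro z ⟨hz1, hz2⟩ hz
    exact (mul_ne_zero hz2 hz1) hz

end HeisenbergGroup

/-! ### Translates of sets of finite measure. -/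

section Translation

variable {V : Type*} [NormedAddCommGroup V] [NormedSpace ℝ V] [FiniteDimensional ℝ V]
  [MeasurableSpace V] [BorelSpace V] {μ : Measure V} [μ.IsAddHaarMeasure]

/-- This follows from continuity of translation in `L¹`, applied to the indicator of `A`. -/
theorem continuous_measureReal_preimage_add_diff {A B : Set V} (hA : MeasurableSet A)
    (hA' : μ A ≠ ∞) (hB : MeasurableSet B) :
    Continuous fun w : V => μ.real ((fun z => z + w) ⁻¹' A \ B) := by
  have hc : Continuous fun v : V =>
      (ContinuousMap.mk (fun ξ : V => ξ + v) (by fun_prop) : C(V, V)) :=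
    ContinuousMap.continuous_of_continuous_uncurry _ (by
      change Continuous fun p : V × V => p.2 + p.1
      fun_prop)
  have h := Continuous.compMeasurePreservingLp (p := 1)
    (continuous_const (y := indicatorConstLp 1 hA hA' (1 : ℝ))) hc
    (fun v => measurePreserving_add_right μ v) (by norm_num)
  refine ((continuous_setIntegral (μ := μ) Bᶜ).comp h).congr fun w => ?_
  simp only [Function.comp_apply]
  rw [Lp.indicatorConstLp_compMeasurePreserving, setIntegral_indicatorConstLp hB.compl]
  simp [Set.sdiff_eq]

/-- Some translate of a set of positive finite measure leaves a superset of finite measure, but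
only slightly. -/
theorem exists_measureReal_preimage_add_diff_mem_Ioo [Nontrivial V] {A B : Set V}
    (hA : MeasurableSet A) (hA' : μ A ≠ ∞) (hA0 : μ A ≠ 0) (hB : MeasurableSet B)
    (hB' : μ B ≠ ∞) (hAB : A ⊆ B) {ε : ℝ} (hε : 0 < ε) :
    ∃ w : V, 0 < μ.real ((fun z => z + w) ⁻¹' A \ B) ∧
      μ.real ((fun z => z + w) ⁻¹' A \ B) < ε := by
  have hpre : ∀ w : V, μ ((fun z => z + w) ⁻¹' A) = μ A := fun w =>
    (measurePreserving_add_right μ w).measure_preimage hA.nullMeasurableSet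
  -- If every translate of `A` lay in `B` up to a null set, integrating the measure of the
  -- intersection over `w` would give `∞ ≤ μ A * μ B`.
  obtain ⟨w₁, hw₁⟩ : ∃ w : V, 0 < μ.real ((fun z => z + w) ⁻¹' A \ B) := by
    by_contra! hcon
    have h1 : ∀ w : V, μ A ≤ ∫⁻ z, B.indicator 1 z * A.indicator 1 (z + w) ∂μ := by
      intro w
      have h0 : μ ((fun z => z + w) ⁻¹' A \ B) = 0 := by
        rcases (ENNReal.toReal_eq_zero_iff _).1 (le_antisymm (hcon w) ENNReal.toReal_nonneg)
          with h | h
        · exact h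
        · exact absurd (measure_mono_top Set.sdiff_subset h) (by rw [hpre]; exact hA')
      calc μ A = μ ((fun z => z + w) ⁻¹' A) := (hpre w).symm
        _ = μ ((fun z => z + w) ⁻¹' A ∩ B) := by
          rw [← measure_inter_add_sdiff _ hB, h0, add_zero]
        _ = ∫⁻ z, ((fun z => z + w) ⁻¹' A ∩ B).indicator 1 z ∂μ := by
          rw [lintegral_indicator_one ((measurable_add_const w hA).inter hB)]
        _ ≤ _ := by
          refine lintegral_mono fun z => ?_
          by_cases hzB : z ∈ B <;> by_cases hzA : z + w ∈ A <;> simp [hzA, hzB, Set.indicator]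
    have h2 : ∫⁻ _ : V, μ A ∂μ ≤ μ A * μ B := by
      refine (lintegral_mono h1).trans ?_
      rw [lintegral_lintegral_swap]
      · calc ∫⁻ z, ∫⁻ w, B.indicator 1 z * A.indicator 1 (z + w) ∂μ ∂μ
            = ∫⁻ z, B.indicator 1 z * μ A ∂μ := by
              refine lintegral_congr fun z => ?_
              rw [lintegral_const_mul' _ _ (by by_cases h : z ∈ B <;> simp [h]),
                lintegral_add_left_eq_self (fun w => A.indicator 1 w) z,
                lintegral_indicator_one hA]
          _ = μ B * μ A := by
              rw [lintegral_mul_const' _ _ hA', lintegral_indicator_one hB]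
          _ ≤ μ A * μ B := (mul_comm _ _).le
      · refine Measurable.aemeasurable ?_
        exact ((measurable_one.indicator hB).comp measurable_snd).mul
          ((measurable_one.indicator hA).comp (measurable_snd.add measurable_fst))
    have : NoncompactSpace V := NormedSpace.noncompactSpace ℝ V
    rw [lintegral_const, measure_univ_of_isAddLeftInvariant, ENNReal.mul_top hA0] at h2
    exact (ENNReal.mul_lt_top hA'.lt_top hB'.lt_top).not_ge h2
  set F : V → ℝ := fun w => μ.real ((fun z => z + w) ⁻¹' A \ B)
  have hF0 : F 0 = 0 := by
    simp [F, Set.sdiff_eq_empty.2 hAB]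
  -- Since `A ⊆ B`, `F` vanishes at `0`; by the intermediate value theorem it takes this positive
  -- value below `ε`.
  have hδ : min (ε / 2) (F w₁) ∈ Set.Icc (F 0) (F w₁) :=
    ⟨by rw [hF0]; exact le_min (by positivity) hw₁.le, min_le_right _ _⟩
  obtain ⟨w, hw⟩ := mem_range_of_exists_le_of_exists_ge
    (continuous_measureReal_preimage_add_diff hA hA' hB) ⟨0, hδ.1⟩ ⟨w₁, hδ.2⟩
  exact ⟨w, lt_of_lt_of_eq (lt_min (by positivity) hw₁) hw.symm,
    lt_of_eq_of_lt hw ((min_le_left _ _).trans_lt (by linarith))⟩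

end Translation

/-! ### Benedicks' theorem for finite sums of matrix coefficients. -/

namespace HeisenbergGroup

variable {m : ℕ}

/-- The vector `(π_λ(z, 0)⁻¹ e_i)_i`. -/
def orbit (lam : ℝ) (e : Fin m → L2 n) (z : Fin n → ℂ) : PiLp 2 fun _ : Fin m => L2 n :=
  WithLp.toLp 2 fun i => (schrodingerRep n lam (of z 0)).symm (e i)

/-- The function `z ↦ ∑ i, ⟪e_i, π_λ(z, 0) a_i⟫`. -/
def coeffSum (lam : ℝ) (e : Fin m → L2 n) (a : PiLp 2 fun _ : Fin m => L2 n)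
    (z : Fin n → ℂ) : ℂ := ⟪orbit lam e z, a⟫

theorem coeffSum_eq_sum (lam : ℝ) (e : Fin m → L2 n) (a : PiLp 2 fun _ : Fin m => L2 n)
    (z : Fin n → ℂ) : coeffSum lam e a z = ∑ i, coeff lam (e i) (a i) z := by
  rw [coeffSum, PiLp.inner_apply]
  refine Finset.sum_congr rfl fun i _ => ?_
  rw [coeff, ← LinearIsometryEquiv.inner_map_map (schrodingerRep n lam (of z 0)) (orbit lam e z i)]
  simp [orbit]

theorem continuous_coeffSum (lam : ℝ) (e : Fin m → L2 n) (a : PiLp 2 fun _ : Fin m => L2 n) :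
    Continuous (coeffSum lam e a) := by
  simp only [funext (coeffSum_eq_sum lam e a)]
  exact continuous_finsetSum _ fun i _ => continuous_coeff lam _ _

theorem norm_orbit_sq (lam : ℝ) {e : Fin m → L2 n} (he : Orthonormal ℂ e) (z : Fin n → ℂ) :
    ‖orbit lam e z‖ ^ 2 = m := by
  rw [PiLp.norm_sq_eq_of_L2]
  simp [orbit, he.1]

theorem memLp_coeffSum {lam : ℝ} (hlam : lam ≠ 0) (e : Fin m → L2 n)
    (a : PiLp 2 fun _ : Fin m => L2 n) : MemLp (coeffSum lam e a) 2 := by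
  simp only [funext (coeffSum_eq_sum lam e a)]
  exact memLp_finsetSum _ fun i _ => memLp_coeff hlam _ _

/-- By Moyal, the conjugate of `coeffSum lam e a` has as Weyl transform `oscConst n lam` times the
finite-rank operator `α ↦ ∑ i, ⟪a i, α⟫ • e i`. -/
theorem integral_conj_coeffSum_mul_coeff {lam : ℝ} (hlam : lam ≠ 0) (e : Fin m → L2 n)
    (a : PiLp 2 fun _ : Fin m => L2 n) (β α : L2 n) :
    ∫ z, starRingEnd ℂ (coeffSum lam e a z) * coeff lam β α z =
      oscConst n lam * ∑ i, ⟪β, e i⟫ * ⟪a i, α⟫ := by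
  have h : ∀ z, starRingEnd ℂ (coeffSum lam e a z) * coeff lam β α z =
      ∑ i, ⟪coeff lam (e i) (a i) z, coeff lam β α z⟫ := by
    intro z
    rw [coeffSum_eq_sum, map_sum, Finset.sum_mul]
    exact Finset.sum_congr rfl fun i _ => by rw [RCLike.inner_apply, mul_comm]
  simp only [h]
  rw [integral_finsetSum _ fun i _ => integrable_inner_coeff hlam _ _ _ _, Finset.mul_sum]
  exact Finset.sum_congr rfl fun i _ => integral_inner_coeff hlam _ _ _ _

/-- Orthonormality of `e` kills the cross terms, so `a ↦ coeffSum lam e a` is a multiple of an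
isometry into `L²`. -/
theorem integral_norm_coeffSum_sq {lam : ℝ} (hlam : lam ≠ 0) {e : Fin m → L2 n}
    (he : Orthonormal ℂ e) (a : PiLp 2 fun _ : Fin m => L2 n) :
    ∫ z, ‖coeffSum lam e a z‖ ^ 2 = oscConst n lam * ‖a‖ ^ 2 := by
  rw [← Complex.ofReal_inj, ← integral_complex_ofReal]
  have h : ∀ z, ((‖coeffSum lam e a z‖ ^ 2 : ℝ) : ℂ) =
      ∑ j, starRingEnd ℂ (coeffSum lam e a z) * coeff lam (e j) (a j) z := by
    intro z
    rw [← Finset.mul_sum, ← coeffSum_eq_sum, mul_comm, Complex.mul_conj,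
      Complex.normSq_eq_norm_sq]
  simp only [h]
  rw [integral_finsetSum]
  · simp only [integral_conj_coeffSum_mul_coeff hlam, orthonormal_iff_ite.1 he]
    rw [← Finset.mul_sum, PiLp.norm_sq_eq_of_L2]
    push_cast
    congr 1
    refine Finset.sum_congr rfl fun j _ => ?_
    rw [Finset.sum_eq_single j (fun i _ hij => by rw [if_neg (Ne.symm hij), zero_mul]) (by simp),
      if_pos rfl, one_mul, inner_self_eq_norm_sq_to_K]
    rfl
  · exact fun j _ => (memLp_coeffSum hlam e a).star.integrable_mul (memLp_coeff hlam _ _)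

/-- An orthonormal family of vectors `a` with `coeffSum lam e a` supported in a set of finite
measure is finite, with an explicit bound on its size. -/
theorem card_mul_oscConst_le {lam : ℝ} (hlam : lam ≠ 0) {e : Fin m → L2 n}
    (he : Orthonormal ℂ e) {N : ℕ} {u : Fin N → PiLp 2 fun _ : Fin m => L2 n}
    (hu : Orthonormal ℂ u) {B : Set (Fin n → ℂ)} (hB : volume B ≠ ∞)
    (huB : ∀ j, ∀ z ∉ B, coeffSum lam e (u j) z = 0) :
    N * oscConst n lam ≤ m * volume.real B := by
  have hint : ∀ j, Integrable fun z => ‖coeffSum lam e (u j) z‖ ^ 2 := fun j =>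
    (memLp_coeffSum hlam e (u j)).integrable_norm_pow (by norm_num)
  calc N * oscConst n lam = ∑ j, ∫ z, ‖coeffSum lam e (u j) z‖ ^ 2 := by
        simp [integral_norm_coeffSum_sq hlam he, hu.1]
    _ = ∑ j, ∫ z in B, ‖coeffSum lam e (u j) z‖ ^ 2 := by
        refine Finset.sum_congr rfl fun j _ => ?_
        rw [setIntegral_eq_integral_of_forall_compl_eq_zero]
        intro z hz
        simp [huB j z hz]
    _ = ∫ z in B, ∑ j, ‖coeffSum lam e (u j) z‖ ^ 2 :=
        (integral_finsetSum _ fun j _ => (hint j).integrableOn).symm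
    _ ≤ ∫ _ in B, (m : ℝ) := by
        refine setIntegral_mono (integrable_finsetSum _ fun j _ => (hint j).integrableOn)
          (integrableOn_const hB) fun z => ?_
        simp only
        -- Bessel's inequality for the family `u` at the vector `orbit lam e z`, whose squared norm
        -- is `m` for every `z`.
        rw [← norm_orbit_sq lam he z]
        refine le_trans (le_of_eq ?_) (hu.sum_inner_products_le (orbit lam e z) (s := Finset.univ))
        exact Finset.sum_congr rfl fun j _ => by rw [coeffSum, norm_inner_symm]
    _ = m * volume.real B := by
        rw [setIntegral_const, smul_eq_mul, mul_comm]

theorem card_mul_oscConst_le_of_linearIndependent {lam : ℝ} (hlam : lam ≠ 0) {e : Fin m → L2 n}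
    (he : Orthonormal ℂ e) {N : ℕ} {b : Fin N → PiLp 2 fun _ : Fin m => L2 n}
    (hb : LinearIndependent ℂ b) {B : Set (Fin n → ℂ)} (hB : volume B ≠ ∞) (hbB : ∀ j, ∀ z ∉ B, coeffSum lam e (b j) z = 0) :
    N * oscConst n lam ≤ m * volume.real B := by
  have hspan : ∀ a ∈ Submodule.span ℂ (Set.range b), ∀ z ∉ B, coeffSum lam e a z = 0 := by
    intro a ha z hz
    induction ha using Submodule.span_induction with
    | mem x hx => obtain ⟨j, rfl⟩ := hx; exact hbB j z hz
    | zero => exact inner_zero_right _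
    | add x y _ _ hx hy =>
      rw [coeffSum] at hx hy ⊢
      rw [inner_add_right, hx, hy, add_zero]
    | smul c x _ hx =>
      rw [coeffSum] at hx ⊢
      rw [inner_smul_right, hx, mul_zero]
  have hN := finrank_span_eq_card hb
  rw [Fintype.card_fin] at hN
  have : FiniteDimensional ℂ (Submodule.span ℂ (Set.range b)) :=
    FiniteDimensional.span_of_finite ℂ (Set.finite_range b)
  have h := card_mul_oscConst_le hlam he
    ((stdOrthonormalBasis ℂ (Submodule.span ℂ (Set.range b))).orthonormal.comp_linearIsometry
      (Submodule.subtypeₗᵢ _)) hB (fun j z hz => hspan _ (Subtype.coe_prop _) z hz)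
  rwa [hN] at h

/-- The diagonal action of `π_λ(w, 0)`. -/
def translate (lam : ℝ) (w : Fin n → ℂ) (a : PiLp 2 fun _ : Fin m => L2 n) :
    PiLp 2 fun _ : Fin m => L2 n :=
  WithLp.toLp 2 fun i => schrodingerRep n lam (of w 0) (a i)

/-- Translating the function costs only a phase and keeps `e` unchanged, so it stays in the same
family. -/
theorem coeffSum_translate (lam : ℝ) (e : Fin m → L2 n) (w : Fin n → ℂ)
    (a : PiLp 2 fun _ : Fin m => L2 n) (z : Fin n → ℂ) :
    coeffSum lam e (translate lam w a) z =
      Complex.exp (((lam * (1 / 2 * symp z w) : ℝ) : ℂ) * Complex.I) *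
        coeffSum lam e a (z + w) := by
  rw [coeffSum_eq_sum, coeffSum_eq_sum, Finset.mul_sum]
  refine Finset.sum_congr rfl fun i _ => ?_
  rw [coeff, translate, coeff, ← inner_smul_right, ← schrodingerRep_of_of]

theorem exists_linearIndependent_coeffSum (hn : 1 ≤ n) {lam : ℝ} {e : Fin m → L2 n}
    {a : PiLp 2 fun _ : Fin m => L2 n} {z₀ : Fin n → ℂ} (hz₀ : coeffSum lam e a z₀ ≠ 0)
    (hfin : volume {z | coeffSum lam e a z ≠ 0} ≠ ∞) (N : ℕ) :
    ∃ (b : Fin N → PiLp 2 fun _ : Fin m => L2 n) (B : Set (Fin n → ℂ)),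
      LinearIndependent ℂ b ∧ MeasurableSet B ∧ {z | coeffSum lam e a z ≠ 0} ⊆ B ∧
      volume B ≠ ∞ ∧ volume.real B < volume.real {z | coeffSum lam e a z ≠ 0} + 1 ∧
      ∀ j, ∀ z ∉ B, coeffSum lam e (b j) z = 0 := by
  set A : Set (Fin n → ℂ) := {z | coeffSum lam e a z ≠ 0} with hA
  have hAo : IsOpen A := (continuous_coeffSum lam e a).isOpen_preimage _ isOpen_ne
  have hA0 : volume A ≠ 0 := (hAo.measure_pos volume ⟨z₀, hz₀⟩).ne'
  -- This makes ℂⁿ nontrivial, hence noncompact, as the translation argument requires.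
  have : Nonempty (Fin n) := ⟨⟨0, hn⟩⟩
  induction N with
  | zero =>
    exact ⟨Fin.elim0, A, linearIndependent_empty_type, hAo.measurableSet, subset_rfl, hfin,
      by linarith, fun j => j.elim0⟩
  | succ N ih =>
    obtain ⟨b, B, hb, hB, hAB, hB', hlt, hbB⟩ := ih
    -- Taking `ε` to be the remaining slack keeps the enlarged set strictly within the fixed budget
    -- of one extra unit of measure.
    obtain ⟨w, hw0, hw1⟩ := exists_measureReal_preimage_add_diff_mem_Ioo hAo.measurableSet hfin hA0
      hB hB' hAB (sub_pos.2 hlt)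
    have hpre : volume ((fun z => z + w) ⁻¹' A) = volume A :=
      (measurePreserving_add_right volume w).measure_preimage hAo.measurableSet.nullMeasurableSet
    obtain ⟨z₁, hz₁A, hz₁B⟩ : ((fun z => z + w) ⁻¹' A \ B).Nonempty := by
      by_contra h
      rw [Set.not_nonempty_iff_eq_empty] at h
      rw [h] at hw0
      simp at hw0
    refine ⟨Fin.cons (translate lam w a) b, B ∪ (fun z => z + w) ⁻¹' A, ?_, ?_, ?_, ?_, ?_, ?_⟩
    · refine linearIndependent_finCons.2 ⟨hb, fun hmem => ?_⟩
      -- Evaluation at `z₁ ∉ B` is a linear functional killing every `b j`, but not the new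
      -- translate.
      have h0 : ∀ x ∈ Submodule.span ℂ (Set.range b), coeffSum lam e x z₁ = 0 := by
        intro x hx
        have hle : Submodule.span ℂ (Set.range b) ≤ (ℂ ∙ orbit lam e z₁)ᗮ := by
          rw [Submodule.span_le]
          rintro _ ⟨j, rfl⟩
          exact Submodule.mem_orthogonal_singleton_iff_inner_right.2 (hbB j z₁ hz₁B)
        exact Submodule.mem_orthogonal_singleton_iff_inner_right.1 (hle hx)
      have h1 := h0 _ hmem
      rw [coeffSum_translate] at h1
      exact (mul_ne_zero (Complex.exp_ne_zero _) hz₁A) h1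
    · exact hB.union (measurable_add_const w hAo.measurableSet)
    · exact hAB.trans Set.subset_union_left
    · exact (measure_union_lt_top hB'.lt_top (by rw [hpre]; exact hfin.lt_top)).ne
    · rw [← Set.union_sdiff_self]
      refine (measureReal_union_le _ _).trans_lt ?_
      linarith
    · intro j z hz
      rw [Set.mem_union, not_or] at hz
      refine Fin.cases ?_ (fun j => ?_) j
      · rw [Fin.cons_zero, coeffSum_translate]
        have : coeffSum lam e a (z + w) = 0 := not_not.1 hz.2
        rw [this, mul_zero]
      · rw [Fin.cons_succ]
        exact hbB j z hz.1

/-- A nonzero `coeffSum` cannot be supported in a set of finite measure. -/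
theorem coeffSum_eq_zero_of_measure_support_ne_top (hn : 1 ≤ n) {lam : ℝ} (hlam : lam ≠ 0)
    {e : Fin m → L2 n} (he : Orthonormal ℂ e) {a : PiLp 2 fun _ : Fin m => L2 n}
    (hfin : volume {z | coeffSum lam e a z ≠ 0} ≠ ∞) (z : Fin n → ℂ) :
    coeffSum lam e a z = 0 := by
  by_contra hz
  have hc := oscConst_pos n hlam
  obtain ⟨N, hN⟩ := exists_nat_gt
    (m * (volume.real {z | coeffSum lam e a z ≠ 0} + 1) / oscConst n lam)
  obtain ⟨b, B, hb, -, -, hB', hlt, hbB⟩ := exists_linearIndependent_coeffSum hn hz hfin N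
  have h := card_mul_oscConst_le_of_linearIndependent hlam he hb hB' hbB
  rw [div_lt_iff₀ hc] at hN
  have : (m : ℝ) * volume.real B ≤ m * (volume.real {z | coeffSum lam e a z ≠ 0} + 1) := by
    gcongr
  linarith

/-- Benedicks' theorem for the Weyl transform: an integrable function supported in a set of finite
measure, whose Weyl transform has finite rank, is zero. -/
theorem ae_eq_zero_of_finiteDimensional_range (hn : 1 ≤ n) {lam : ℝ} (hlam : lam ≠ 0)
    {g : (Fin n → ℂ) → ℂ} (hg : Integrable g) (hfin : volume {z | g z ≠ 0} ≠ ∞)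
    (T : L2 n →L[ℂ] L2 n) [FiniteDimensional ℂ (LinearMap.range T.toLinearMap)]
    (hT : ∀ β α : L2 n, ∫ z, g z * coeff lam β α z = ⟪β, T α⟫) : g =ᵐ[volume] 0 := by
  set R := LinearMap.range T.toLinearMap
  set e₀ := stdOrthonormalBasis ℂ R
  set e : Fin (Module.finrank ℂ R) → L2 n := fun i => e₀ i with he_def
  have he : Orthonormal ℂ e := e₀.orthonormal.comp_linearIsometry R.subtypeₗᵢ
  set a : PiLp 2 fun _ : Fin (Module.finrank ℂ R) => L2 n :=
    WithLp.toLp 2 fun i => ContinuousLinearMap.adjoint T (e i)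
  -- Expanding in the basis `e` of the range writes `T` as a sum of rank-one operators with vectors
  -- `e i` and `a i`.
  have hTe : ∀ α, T α = ∑ i, ⟪e i, T α⟫ • e i := by
    intro α
    have h := congrArg Subtype.val (e₀.sum_repr' ⟨T α, LinearMap.mem_range_self _ α⟩)
    rw [Submodule.coe_sum] at h
    exact h.symm
  have hTβ : ∀ β α, ⟪β, T α⟫ = ∑ i, ⟪β, e i⟫ * ⟪a i, α⟫ := by
    intro β α
    rw [hTe, inner_sum]
    refine Finset.sum_congr rfl fun i _ => ?_
    rw [inner_smul_right, mul_comm]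
    congr 1
    exact (ContinuousLinearMap.adjoint_inner_left T α (e i)).symm
  have hi1 : ∀ β α, Integrable fun z => g z * coeff lam β α z := fun β α =>
    hg.mul_bdd (c := ‖β‖ * ‖α‖) (continuous_coeff lam β α).aestronglyMeasurable
      (Eventually.of_forall (norm_coeff_le lam β α))
  have hi2 : ∀ β α, Integrable fun z => starRingEnd ℂ (coeffSum lam e a z) * coeff lam β α z :=
    fun β α => (memLp_coeffSum hlam e a).star.integrable_mul (memLp_coeff hlam _ _)
  -- Both terms have Weyl transform `oscConst n lam` times `T`, so injectivity forces the difference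
  -- to vanish.
  have hG : (fun z => oscConst n lam * g z - starRingEnd ℂ (coeffSum lam e a z)) =ᵐ[volume] 0 := by
    have hmul : ∀ β α, (fun z => (oscConst n lam * g z - starRingEnd ℂ (coeffSum lam e a z)) *
        coeff lam β α z) = fun z => oscConst n lam * (g z * coeff lam β α z) -
          starRingEnd ℂ (coeffSum lam e a z) * coeff lam β α z := fun β α => by
      ext z; ring
    refine ae_eq_zero_of_integral_mul_coeff hlam (fun β α => ?_) fun β α => ?_
    · rw [hmul]
      exact ((hi1 β α).const_mul _).sub (hi2 β α)
    · rw [hmul, integral_sub ((hi1 β α).const_mul _) (hi2 β α), integral_const_mul, hT, hTβ,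
        integral_conj_coeffSum_mul_coeff hlam, sub_self]
  have hc : (oscConst n lam : ℂ) ≠ 0 := Complex.ofReal_ne_zero.2 (oscConst_pos n hlam).ne'
  have hzero := coeffSum_eq_zero_of_measure_support_ne_top hn hlam he (a := a) (by
    refine ne_top_of_le_ne_top hfin (measure_mono_ae ?_)
    filter_upwards [hG] with z hz hz1 hz2
    rw [Pi.zero_apply, hz2, mul_zero, zero_sub, neg_eq_zero, map_eq_zero] at hz
    exact hz1 hz)
  filter_upwards [hG] with z hz
  rw [Pi.zero_apply, hzero, map_zero, sub_zero] at hz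
  exact (mul_eq_zero.1 hz).resolve_left hc

end HeisenbergGroup

/-! ### Fourier inversion in the central variable and reduction to ℂⁿ. -/

theorem continuous_integral_mul_cexp {F : ℝ → ℂ} (hF : Integrable F) :
    Continuous fun lam : ℝ => ∫ t, F t * Complex.exp (((lam * t : ℝ) : ℂ) * Complex.I) := by
  refine continuous_of_dominated (bound := fun t => ‖F t‖)
    (fun lam => (hF.mul_cexp (θ := fun t => lam * t) (by fun_prop)).1) (fun lam => ?_) hF.norm
    (Eventually.of_forall fun t => by fun_prop)
  exact Eventually.of_forall fun t => by
    rw [norm_mul, Complex.norm_exp_ofReal_mul_I, mul_one]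

/-- An integrable function on the line whose Fourier transform vanishes at all nonzero rationals
is zero. -/
theorem ae_eq_zero_of_forall_rat {F : ℝ → ℂ} (hF : Integrable F)
    (h : ∀ q : ℚ, q ≠ 0 → ∫ t, F t * Complex.exp ((((q : ℝ) * t : ℝ) : ℂ) * Complex.I) = 0) :
    F =ᵐ[volume] 0 := by
  -- The transform is continuous and the nonzero rationals are dense, so it vanishes at every
  -- frequency, including `0`.
  have hall := Continuous.ext_on ((Rat.denseRange_cast (𝕜 := ℝ)).sdiff_singleton 0)
    (continuous_integral_mul_cexp hF) continuous_const (by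
      rintro _ ⟨⟨q, rfl⟩, hq⟩
      exact h q fun h0 => hq (by simp [h0]) : Set.EqOn _ (fun _ => (0 : ℂ)) _)
  refine ae_eq_zero_of_integral_mul_cexp hF fun L => ?_
  rw [← congrFun hall (L 1)]
  refine integral_congr_ae (Eventually.of_forall fun t => ?_)
  have : L t = L 1 * t := by
    conv_lhs => rw [← mul_one t, ← smul_eq_mul, map_smul, smul_eq_mul, mul_comm]
  simp only [this]

namespace HeisenbergGroup

/-- The partial Fourier transform `f^λ(z) = ∫ f(z, t) e^{iλt} dt` in the central variable. -/
def centralFourier (f : Lp ℂ 1 (volume : Measure (HeisenbergGroup n))) (lam : ℝ)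
    (z : Fin n → ℂ) : ℂ :=
  ∫ t, f (of z t) * Complex.exp (((lam * t : ℝ) : ℂ) * Complex.I)

theorem integrable_of (f : Lp ℂ 1 (volume : Measure (HeisenbergGroup n))) :
    Integrable (fun p : (Fin n → ℂ) × ℝ => f (of p.1 p.2)) (volume.prod volume) :=
  L1.integrable_coeFn f

theorem integrable_of_mul_cexp (f : Lp ℂ 1 (volume : Measure (HeisenbergGroup n))) (lam : ℝ) :
    Integrable (fun p : (Fin n → ℂ) × ℝ =>
      f (of p.1 p.2) * Complex.exp (((lam * p.2 : ℝ) : ℂ) * Complex.I)) (volume.prod volume) :=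
  (integrable_of f).mul_cexp (θ := fun p => lam * p.2) (by fun_prop)

theorem integrable_centralFourier (f : Lp ℂ 1 (volume : Measure (HeisenbergGroup n)))
    (lam : ℝ) : Integrable (centralFourier f lam) :=
  (integrable_of_mul_cexp f lam).integral_prod_left

/-- The group Fourier transform is the Weyl transform of the partial Fourier transform. -/
theorem integral_centralFourier_mul_coeff
    (f : Lp ℂ 1 (volume : Measure (HeisenbergGroup n))) (lam : ℝ) (β α : L2 n) :
    ∫ z, centralFourier f lam z * coeff lam β α z = ⟪β, fourierTransform f lam α⟫ := by
  have hint : Integrable (fun p : (Fin n → ℂ) × ℝ =>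
      f (of p.1 p.2) * Complex.exp (((lam * p.2 : ℝ) : ℂ) * Complex.I) * coeff lam β α p.1)
      (volume.prod volume) :=
    (integrable_of_mul_cexp f lam).mul_bdd (c := ‖β‖ * ‖α‖)
      ((continuous_coeff lam β α).comp continuous_fst).aestronglyMeasurable
      (Eventually.of_forall fun p => norm_coeff_le lam β α p.1)
  rw [fourierTransform_apply, ← integral_inner (integrable_schrodingerRep lam f α)]
  calc ∫ z, centralFourier f lam z * coeff lam β α z
      = ∫ z, ∫ t, f (of z t) * Complex.exp (((lam * t : ℝ) : ℂ) * Complex.I) *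
          coeff lam β α z := by
        simp only [integral_mul_const, centralFourier]
    _ = ∫ p : (Fin n → ℂ) × ℝ, f (of p.1 p.2) *
          Complex.exp (((lam * p.2 : ℝ) : ℂ) * Complex.I) * coeff lam β α p.1 :=
        (integral_prod _ hint).symm
    _ = ∫ p : (Fin n → ℂ) × ℝ, ⟪β, f (of p.1 p.2) • schrodingerRep n lam (of p.1 p.2) α⟫ := by
        refine integral_congr_ae (Eventually.of_forall fun p => ?_)
        simp only
        rw [schrodingerRep_of, inner_smul_right, inner_smul_right, mul_assoc, coeff]
    _ = _ := rfl

theorem ae_centralFourier_ne_zero {A : Set (Fin n → ℂ)}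
    {f : Lp ℂ 1 (volume : Measure (HeisenbergGroup n))}
    (hfA : ∀ᵐ g : HeisenbergGroup n, f g ≠ 0 → g.z ∈ A) (lam : ℝ) :
    ∀ᵐ z, centralFourier f lam z ≠ 0 → z ∈ A := by
  have h : ∀ᵐ p : (Fin n → ℂ) × ℝ ∂(volume.prod volume), f (of p.1 p.2) ≠ 0 → p.1 ∈ A := hfA
  filter_upwards [Measure.ae_ae_of_ae_prod h] with z hz hne
  by_contra hzA
  refine hne (integral_eq_zero_of_ae ?_)
  filter_upwards [hz] with t ht
  have : f (of z t) = 0 := by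
    by_contra h0
    exact hzA (ht h0)
  simp [this]

/-- The exceptional null set of `z` depends on `lam`. Restricting to rational frequencies leaves a
countable union of null sets, so almost every slice in `t` has vanishing transform. -/
theorem eq_zero_of_centralFourier {f : Lp ℂ 1 (volume : Measure (HeisenbergGroup n))}
    (h : ∀ lam : ℝ, lam ≠ 0 → centralFourier f lam =ᵐ[volume] 0) : f = 0 := by
  have hae : ∀ᵐ z, ∀ q : ℚ, q ≠ 0 → centralFourier f q z = 0 := by
    rw [ae_all_iff]
    intro q
    by_cases hq : q = 0
    · exact Eventually.of_forall fun z h0 => absurd hq h0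
    · filter_upwards [h q (by exact_mod_cast hq)] with z hz _ using hz
  have hprod : ∀ᵐ p : (Fin n → ℂ) × ℝ ∂(volume.prod volume), f (of p.1 p.2) = 0 := by
    have h2 : ∫ p : (Fin n → ℂ) × ℝ, ‖f (of p.1 p.2)‖ ∂(volume.prod volume) = 0 := by
      rw [integral_prod _ (integrable_of f).norm]
      refine integral_eq_zero_of_ae ?_
      filter_upwards [hae, (integrable_of f).prod_right_ae] with z hz hzi
      refine integral_eq_zero_of_ae ?_
      filter_upwards [ae_eq_zero_of_forall_rat hzi hz] with t ht
      rw [ht]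
      simp
    filter_upwards [(integral_eq_zero_iff_of_nonneg (fun _ => norm_nonneg _)
      (integrable_of f).norm).1 h2] with p hp
    exact norm_eq_zero.1 hp
  refine (Lp.eq_zero_iff_ae_eq_zero).2 ?_
  exact hprod

end HeisenbergGroup

end

theorem theorem6p6 (n : ℕ) (hn : 1 ≤ n) (A : Set (Fin n → ℂ)) (hA : volume A < ∞)
    (f : Lp ℂ 1 (volume : Measure (HeisenbergGroup n)))
    (hfA : ∀ᵐ g : HeisenbergGroup n, f g ≠ 0 → g.z ∈ A)
    (hrank : ∀ lam : ℝ, lam ≠ 0 →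
      FiniteDimensional ℂ
        (LinearMap.range (HeisenbergGroup.fourierTransform f lam).toLinearMap)) :
    f = 0 := by
  refine HeisenbergGroup.eq_zero_of_centralFourier fun lam hlam => ?_
  have := hrank lam hlam
  refine HeisenbergGroup.ae_eq_zero_of_finiteDimensional_range hn hlam
    (HeisenbergGroup.integrable_centralFourier f lam) ?_
    (HeisenbergGroup.fourierTransform f lam)
    (HeisenbergGroup.integral_centralFourier_mul_coeff f lam)
  exact ne_top_of_le_ne_top hA.ne
    (measure_mono_ae (HeisenbergGroup.ae_centralFourier_ne_zero hfA lam))
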